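/- Let $M$ be a two-dimensional smooth manifold with a Riemannian metric $\alpha=\sqrt{a_{ij}(x)y^iy^j}$ and a smooth $1$-form $\beta=b_i(x)y^i$, and let $b(x)=\|\beta_x\|_\alpha=\sup_{y\neq 0}|\beta_x(y)|/\alpha(x,y)$. Let $k_1<k_2$ be real constants, fix a sign $\pm$, and let $F=\alpha\,\phi(\beta/\alpha)$ with $$\phi(s)=\big\{(1+k_1s^2)(1+k_2s^2)\big\}^{1/4}\exp\Big(\int_0^s\tau(t)\,dt\Big),\qquad \tau(t)=\frac{\pm\sqrt{k_2-k_1}}{2(1+k_1t^2)\sqrt{1+k_2t^2}}.$$ Say that $F$ is positive definite on $TM\setminus 0$ if $F$ is $C^\infty$ and positive on $TM\setminus 0$, $F(x,cy)=cF(x,y)$ for $c>0$, and for all $x\in M$ and $y\in T_xM\setminus\{0\}$ the fundamental tensor $$g_y(u,v)=\tfrac12\,\frac{\partial^2}{\partial s\,\partial t}\Big|_{s=t=0}F^2(x,y+su+tv)$$ is positive definite on $T_xM$. Then $F$ is positive definite on $TM\setminus0$ if and only if $$1+k_1\,b(x)^2>0\quad\text{for all }x\in M .$$ Moreover, if this condition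 holds, then at every value $s=\beta(y)/\alpha(y)$, $y\in TM\setminus0$, the formula for $\phi(s)$ is well defined: for all $t$ between $0$ and $s$ one has $1+k_1t^2\neq0$ and $1+k_2t^2>0$, and $(1+k_1s^2)(1+k_2s^2)\ge0$. (In the equivalence, where roots of negative numbers or a divergent integral would occur in $\phi$, they are given conventional real values; then $\phi(s)=0$ wherever $1+k_1s^2=0$.) -/

import Mathlib

open scoped Manifold ContDiff Bundle

noncomputable section

/-- The integrand `τ(s) = ε √(k₂ - k₁) / (2 (1 + k₁ s²) √(1 + k₂ s²))`, where `ε = ± 1`. -/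
def alphaBetaTau (ε k₁ k₂ s : ℝ) : ℝ :=
  ε * √(k₂ - k₁) / (2 * (1 + k₁ * s ^ 2) * √(1 + k₂ * s ^ 2))

/-- `φ(s) = {(1 + k₁ s²)(1 + k₂ s²)}^{1/4} exp (∫₀ˢ τ)`. -/
def alphaBetaPhi (ε k₁ k₂ s : ℝ) : ℝ :=
  ((1 + k₁ * s ^ 2) * (1 + k₂ * s ^ 2)) ^ (1 / 4 : ℝ) *
    Real.exp (∫ t in (0 : ℝ)..s, alphaBetaTau ε k₁ k₂ t)

/-- All the expressions in the formula for `φ(s)` make sense: on the interval between `0` and `s`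
the quantity under the square root in `τ` is positive and the denominator of `τ` does not vanish
(so `τ` is continuous there), and the quantity under the fourth root is nonnegative. -/
def AlphaBetaPhiDefinedAt (k₁ k₂ s : ℝ) : Prop :=
  (∀ t ∈ Set.uIcc 0 s, 1 + k₁ * t ^ 2 ≠ 0 ∧ 0 < 1 + k₂ * t ^ 2) ∧
    0 ≤ (1 + k₁ * s ^ 2) * (1 + k₂ * s ^ 2)

section Finsler

variable {E : Type*} [NormedAddCommGroup E] [NormedSpace ℝ E]
  {H : Type*} [TopologicalSpace H] (I : ModelWithCorners ℝ E H)
  {M : Type*} [TopologicalSpace M] [ChartedSpace H M]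

/-- The fundamental tensor of a function `F` on the tangent bundle:
`g_y(u, v) = ½ ∂²/∂s∂t [F²(y + s u + t v)]` at `s = t = 0`, i.e. `g_ij = ½ [F²]_{y^i y^j}`. -/
def fundamentalTensor (F : (x : M) → TangentSpace I x → ℝ) (x : M)
    (y u v : TangentSpace I x) : ℝ :=
  (1 / 2) * deriv (fun s : ℝ => deriv (fun t : ℝ => F x (y + s • u + t • v) ^ 2) 0) 0

/-- `F` is a positive definite Finsler metric on `TM ∖ 0`. -/
structure IsPositiveDefiniteFinsler [IsManifold I 1 M]
    (F : (x : M) → TangentSpace I x → ℝ) : Prop where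
  smooth : ContMDiffOn I.tangent 𝓘(ℝ) ∞ (fun p : TangentBundle I M => F p.1 p.2)
    {p : TangentBundle I M | p.2 ≠ 0}
  pos : ∀ (x : M) (y : TangentSpace I x), y ≠ 0 → 0 < F x y
  homogeneous : ∀ (x : M) (y : TangentSpace I x) (c : ℝ), 0 < c → F x (c • y) = c * F x y
  posDef : ∀ (x : M) (y : TangentSpace I x), y ≠ 0 →
    ∀ u : TangentSpace I x, u ≠ 0 → 0 < fundamentalTensor I F x y u u

end Finsler

section AlphaBeta

variable {E : Type*} [NormedAddCommGroup E] [NormedSpace ℝ E]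
  {H : Type*} [TopologicalSpace H] (I : ModelWithCorners ℝ E H)
  {M : Type*} [TopologicalSpace M] [ChartedSpace H M]
  [Bundle.RiemannianBundle (fun x : M => TangentSpace I x)]

/-- The `(α, β)`-metric `F = α φ(β / α)`, where `α(x, y) = ‖y‖` is the norm of the Riemannian
metric on `M` and `φ` is a function of one real variable. -/
def alphaBetaMetric (φ : ℝ → ℝ) (β : (x : M) → TangentSpace I x →L[ℝ] ℝ) (x : M)
    (y : TangentSpace I x) : ℝ :=
  ‖y‖ * φ (β x y / ‖y‖)

end AlphaBeta

end

/-! Write `A = 1 + k₁s²`, `B = 1 + k₂s²`, `w = φ'/φ`, `b = ‖β x‖`. Half the second derivative of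
`F²` along `u` is `(D_u F)² + F · D_u² F`, and for `u` not parallel to `y` the factor `D_u² F` is a
positive multiple of `φ - sφ' + xφ''` with `x ≥ 0`; Bessel's inequality gives `s² + x ≤ b²`. For
this `φ`, `φ'' / φ = (k₁/A)(1 - s w) + 3(k₂ - k₁)/(4AB²)`, so `φ - sφ' + xφ''` is `φ` times `(1 - s
w)(1 + k₁(s² + x))/A + 3x(k₂ - k₁)/(4AB²)`. Since `1 - s w > 0` where `A > 0`, everything is
positive once `1 + k₁b² > 0` (`one_sub_add_mul_alphaBetaSecondRatio_pos`,
`dirDeriv_sq_add_mul_dirDeriv₂_pos`). Conversely, if `1 + k₁b² ≤ 0` at some point, then `k₁ < 0` and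
the zero `1/√(-k₁)` of `A` is at most `b`. In dimension two `β/α` takes every value in `[-b, b]`
(`exists_ne_zero_apply_div_norm_eq`), so `F` vanishes at some `y ≠ 0`. -/

/-! ### Domain, smoothness and sign of `φ` -/

theorem one_add_mul_sq_pos_of_sq_le {k s b : ℝ} (h : 0 < 1 + k * b ^ 2) (hs : s ^ 2 ≤ b ^ 2) :
    0 < 1 + k * s ^ 2 := by
  rcases le_total 0 k with hk | hk
  · positivity
  · nlinarith [mul_le_mul_of_nonpos_left hs hk]

theorem one_add_mul_sq_pos_of_lt {k₁ k₂ s : ℝ} (hk : k₁ < k₂) (h : 0 < 1 + k₁ * s ^ 2) :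
    0 < 1 + k₂ * s ^ 2 := by
  nlinarith [mul_le_mul_of_nonneg_right hk.le (sq_nonneg s)]

theorem sq_le_sq_of_mem_uIcc_zero {s t : ℝ} (ht : t ∈ Set.uIcc 0 s) : t ^ 2 ≤ s ^ 2 := by
  rw [sq_le_sq]
  simpa using Set.abs_sub_left_of_mem_uIcc ht

theorem alphaBetaPhiDefinedAt_of_pos {k₁ k₂ s : ℝ} (hk : k₁ < k₂) (h : 0 < 1 + k₁ * s ^ 2) :
    AlphaBetaPhiDefinedAt k₁ k₂ s := by
  refine ⟨fun t ht => ?_, (mul_pos h (one_add_mul_sq_pos_of_lt hk h)).le⟩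
  have ht' := one_add_mul_sq_pos_of_sq_le h (sq_le_sq_of_mem_uIcc_zero ht)
  exact ⟨ht'.ne', one_add_mul_sq_pos_of_lt hk ht'⟩

theorem isOpen_one_add_mul_sq_pos (k : ℝ) : IsOpen {s : ℝ | 0 < 1 + k * s ^ 2} :=
  isOpen_lt continuous_const (by fun_prop)

theorem contDiffAt_alphaBetaTau (ε : ℝ) {k₁ k₂ s : ℝ} (hk : k₁ < k₂)
    (h : 0 < 1 + k₁ * s ^ 2) : ContDiffAt ℝ ∞ (alphaBetaTau ε k₁ k₂) s := by
  have hB := one_add_mul_sq_pos_of_lt hk h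
  unfold alphaBetaTau
  refine ContDiffAt.div (by fun_prop)
    (ContDiffAt.mul (by fun_prop) (ContDiffAt.sqrt (by fun_prop) hB.ne')) ?_
  positivity

theorem hasDerivAt_integral_alphaBetaTau (ε : ℝ) {k₁ k₂ s : ℝ} (hk : k₁ < k₂)
    (h : 0 < 1 + k₁ * s ^ 2) :
    HasDerivAt (fun s => ∫ t in (0 : ℝ)..s, alphaBetaTau ε k₁ k₂ t) (alphaBetaTau ε k₁ k₂ s) s := by
  have hcont : ContinuousOn (alphaBetaTau ε k₁ k₂) {s : ℝ | 0 < 1 + k₁ * s ^ 2} := fun t ht =>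
    (contDiffAt_alphaBetaTau ε hk ht).continuousAt.continuousWithinAt
  refine intervalIntegral.integral_hasDerivAt_right ?_ ?_
    (contDiffAt_alphaBetaTau ε hk h).continuousAt
  · exact (hcont.mono fun t ht =>
      one_add_mul_sq_pos_of_sq_le h (sq_le_sq_of_mem_uIcc_zero ht)).intervalIntegrable
  · exact hcont.stronglyMeasurableAtFilter (isOpen_one_add_mul_sq_pos k₁) s h

/-- The integral is smooth because its derivative `τ` is smooth on the open set where `1 + k₁s² >
0`; the fourth root is taken of a positive number there. -/
theorem contDiffAt_alphaBetaPhi (ε : ℝ) {k₁ k₂ s : ℝ} (hk : k₁ < k₂)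
    (h : 0 < 1 + k₁ * s ^ 2) : ContDiffAt ℝ ∞ (alphaBetaPhi ε k₁ k₂) s := by
  have hopen := isOpen_one_add_mul_sq_pos k₁
  have hint : ContDiffOn ℝ ∞ (fun s => ∫ t in (0 : ℝ)..s, alphaBetaTau ε k₁ k₂ t)
      {s : ℝ | 0 < 1 + k₁ * s ^ 2} := by
    rw [contDiffOn_infty_iff_deriv_of_isOpen hopen]
    refine ⟨fun t ht => (hasDerivAt_integral_alphaBetaTau ε hk
      ht).differentiableAt.differentiableWithinAt, ?_⟩
    refine ContDiffOn.congr (f := alphaBetaTau ε k₁ k₂) (fun t ht =>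
      (contDiffAt_alphaBetaTau ε hk ht).contDiffWithinAt) fun t ht => ?_
    exact (hasDerivAt_integral_alphaBetaTau ε hk ht).deriv
  have hint' := hint.contDiffAt (hopen.mem_nhds h)
  have hB := one_add_mul_sq_pos_of_lt hk h
  unfold alphaBetaPhi
  have hAB : ContDiffAt ℝ ∞ (fun s : ℝ => (1 + k₁ * s ^ 2) * (1 + k₂ * s ^ 2)) s := by fun_prop
  exact (hAB.rpow_const_of_ne (mul_pos h hB).ne').mul hint'.exp

theorem alphaBetaPhi_pos (ε : ℝ) {k₁ k₂ s : ℝ} (hk : k₁ < k₂) (h : 0 < 1 + k₁ * s ^ 2) :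
    0 < alphaBetaPhi ε k₁ k₂ s :=
  mul_pos (Real.rpow_pos_of_pos (mul_pos h (one_add_mul_sq_pos_of_lt hk h)) _) (Real.exp_pos _)

/-- The fourth root of `0` is `0`, and the exponential factor is a real number whatever value the
possibly divergent integral receives. -/
theorem alphaBetaPhi_eq_zero (ε : ℝ) {k₁ k₂ s : ℝ} (h : 1 + k₁ * s ^ 2 = 0) :
    alphaBetaPhi ε k₁ k₂ s = 0 := by
  simp [alphaBetaPhi, h]

/-! ### Derivatives of `φ` and the convexity inequality -/

noncomputable section

/-- The logarithmic derivative of `alphaBetaPhi`. -/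
def alphaBetaLogDeriv (ε k₁ k₂ s : ℝ) : ℝ :=
  (k₁ * s / (1 + k₁ * s ^ 2) + k₂ * s / (1 + k₂ * s ^ 2)) / 2 + alphaBetaTau ε k₁ k₂ s

/-- The second derivative of `alphaBetaPhi`, divided by `alphaBetaPhi`. -/
def alphaBetaSecondRatio (ε k₁ k₂ s : ℝ) : ℝ :=
  k₁ / (1 + k₁ * s ^ 2) * (1 - s * alphaBetaLogDeriv ε k₁ k₂ s) +
    3 * (k₂ - k₁) / (4 * (1 + k₁ * s ^ 2) * (1 + k₂ * s ^ 2) ^ 2)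

end

theorem hasDerivAt_alphaBetaPhi (ε : ℝ) {k₁ k₂ s : ℝ} (hk : k₁ < k₂)
    (h : 0 < 1 + k₁ * s ^ 2) :
    HasDerivAt (alphaBetaPhi ε k₁ k₂)
      (alphaBetaPhi ε k₁ k₂ s * alphaBetaLogDeriv ε k₁ k₂ s) s := by
  have hB := one_add_mul_sq_pos_of_lt hk h
  have hA' : HasDerivAt (fun s : ℝ => 1 + k₁ * s ^ 2) (k₁ * (2 * s)) s := by
    simpa using ((hasDerivAt_pow 2 s).const_mul k₁).const_add 1
  have hB' : HasDerivAt (fun s : ℝ => 1 + k₂ * s ^ 2) (k₂ * (2 * s)) s := by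
    simpa using ((hasDerivAt_pow 2 s).const_mul k₂).const_add 1
  have hAB := mul_pos h hB
  have := ((hA'.mul hB').rpow_const (p := 1 / 4) (Or.inl hAB.ne')).mul
    (hasDerivAt_integral_alphaBetaTau ε hk h).exp
  refine this.congr_deriv ?_
  simp only [Pi.mul_apply]
  rw [Real.rpow_sub_one hAB.ne']
  unfold alphaBetaLogDeriv alphaBetaPhi
  generalize alphaBetaTau ε k₁ k₂ s = T
  generalize Real.exp _ = e
  generalize ((1 + k₁ * s ^ 2) * (1 + k₂ * s ^ 2)) ^ (1 / 4 : ℝ) = r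
  have hA0 := h.ne'
  have hB0 := hB.ne'
  generalize 1 + k₁ * s ^ 2 = A at hA0 ⊢
  generalize 1 + k₂ * s ^ 2 = B at hB0 ⊢
  field_simp
  ring

/-- This is `w' = φ''/φ - w²` for `w = φ'/φ`. The form chosen for `φ''/φ` isolates a multiple of `1
- s w`, leaving a positive remainder. -/
theorem hasDerivAt_alphaBetaLogDeriv {ε k₁ k₂ s : ℝ} (hε : ε ^ 2 = 1) (hk : k₁ < k₂)
    (h : 0 < 1 + k₁ * s ^ 2) :
    HasDerivAt (alphaBetaLogDeriv ε k₁ k₂)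
      (alphaBetaSecondRatio ε k₁ k₂ s - alphaBetaLogDeriv ε k₁ k₂ s ^ 2) s := by
  have hB := one_add_mul_sq_pos_of_lt hk h
  have hA' : HasDerivAt (fun s : ℝ => 1 + k₁ * s ^ 2) (k₁ * (2 * s)) s := by
    simpa using ((hasDerivAt_pow 2 s).const_mul k₁).const_add 1
  have hB' : HasDerivAt (fun s : ℝ => 1 + k₂ * s ^ 2) (k₂ * (2 * s)) s := by
    simpa using ((hasDerivAt_pow 2 s).const_mul k₂).const_add 1
  have hid := hasDerivAt_id' s
  have hT := (hasDerivAt_const s (ε * √(k₂ - k₁))).div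
    ((hA'.const_mul 2).mul (hB'.sqrt hB.ne')) (by simp only [Pi.mul_apply]; positivity)
  have := ((((hid.const_mul k₁).div hA' h.ne').add
    ((hid.const_mul k₂).div hB' hB.ne')).div_const 2).add hT
  refine this.congr_deriv ?_
  simp only [Pi.mul_apply]
  unfold alphaBetaSecondRatio alphaBetaLogDeriv alphaBetaTau
  have hc : (ε * √(k₂ - k₁)) ^ 2 = k₂ - k₁ := by
    rw [mul_pow, hε, Real.sq_sqrt (sub_pos.2 hk).le, one_mul]
  have hr : √(1 + k₂ * s ^ 2) ^ 2 = 1 + k₂ * s ^ 2 := Real.sq_sqrt hB.le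
  have hr0 : √(1 + k₂ * s ^ 2) ≠ 0 := (Real.sqrt_pos.2 hB).ne'
  generalize ε * √(k₂ - k₁) = c at *
  generalize √(1 + k₂ * s ^ 2) = r at *
  have hA0 : 1 + k₁ * s ^ 2 ≠ 0 := h.ne'
  -- Eliminating `k₂` through `c² = k₂ - k₁` leaves a rational identity modulo `r² = 1 + k₂s²`.
  have hk2 : k₂ = k₁ + c ^ 2 := by linarith
  simp only [← hr]
  generalize hA : 1 + k₁ * s ^ 2 = A at *
  clear hT this hA' hB' hid
  subst hk2
  field_simp
  subst hA
  grind

/-- With `c = ε√(k₂ - k₁)` and `r = √B`, the quantity equals `(A + B - c s r)/(2AB)`, and `(c s r)²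
= (B - A)B < (A + B)²`. -/
theorem one_sub_mul_alphaBetaLogDeriv_pos {ε k₁ k₂ s : ℝ} (hε : ε ^ 2 = 1) (hk : k₁ < k₂)
    (h : 0 < 1 + k₁ * s ^ 2) : 0 < 1 - s * alphaBetaLogDeriv ε k₁ k₂ s := by
  have hB := one_add_mul_sq_pos_of_lt hk h
  have hc : (ε * √(k₂ - k₁)) ^ 2 = k₂ - k₁ := by
    rw [mul_pow, hε, Real.sq_sqrt (sub_pos.2 hk).le, one_mul]
  have hr : √(1 + k₂ * s ^ 2) ^ 2 = 1 + k₂ * s ^ 2 := Real.sq_sqrt hB.le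
  have hr0 : 0 < √(1 + k₂ * s ^ 2) := Real.sqrt_pos.2 hB
  unfold alphaBetaLogDeriv alphaBetaTau
  generalize ε * √(k₂ - k₁) = c at *
  have key : c * s * √(1 + k₂ * s ^ 2) < (1 + k₁ * s ^ 2) + (1 + k₂ * s ^ 2) := by
    refine lt_of_pow_lt_pow_left₀ 2 (by positivity) ?_
    rw [mul_pow, mul_pow, hr, hc]
    nlinarith [mul_pos h hB, mul_pos h h]
  have : 1 - s * ((k₁ * s / (1 + k₁ * s ^ 2) + k₂ * s / (1 + k₂ * s ^ 2)) / 2 +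
      c / (2 * (1 + k₁ * s ^ 2) * √(1 + k₂ * s ^ 2))) =
      ((1 + k₁ * s ^ 2) + (1 + k₂ * s ^ 2) - c * s * √(1 + k₂ * s ^ 2)) /
        (2 * (1 + k₁ * s ^ 2) * (1 + k₂ * s ^ 2)) := by
    have h1 : c / (2 * (1 + k₁ * s ^ 2) * √(1 + k₂ * s ^ 2)) =
        c * √(1 + k₂ * s ^ 2) / (2 * (1 + k₁ * s ^ 2) * (1 + k₂ * s ^ 2)) := by
      rw [div_eq_div_iff (by positivity) (by positivity)]
      linear_combination (-2 * c * (1 + k₁ * s ^ 2)) * hr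
    rw [h1]
    have hA0 := h.ne'
    have hB0 := hB.ne'
    generalize √(1 + k₂ * s ^ 2) = r
    generalize hA : 1 + k₁ * s ^ 2 = A at hA0 ⊢
    generalize hB : 1 + k₂ * s ^ 2 = B at hB0 ⊢
    field_simp
    linear_combination -B * hA - A * hB
  rw [this]
  exact div_pos (by linarith) (by positivity)

theorem one_sub_add_mul_alphaBetaSecondRatio_pos {ε k₁ k₂ s x b : ℝ} (hε : ε ^ 2 = 1)
    (hk : k₁ < k₂) (hb : 0 < 1 + k₁ * b ^ 2) (hx : 0 ≤ x) (hxb : s ^ 2 + x ≤ b ^ 2) :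
    0 < 1 - s * alphaBetaLogDeriv ε k₁ k₂ s + x * alphaBetaSecondRatio ε k₁ k₂ s := by
  have h := one_add_mul_sq_pos_of_sq_le hb (by linarith : s ^ 2 ≤ b ^ 2)
  have hB := one_add_mul_sq_pos_of_lt hk h
  have hpos := one_sub_mul_alphaBetaLogDeriv_pos hε hk h
  -- `s² + x` is written as the square of its root so that the bound by `b²` applies.
  have hsx : 0 < 1 + k₁ * (s ^ 2 + x) := by
    have := one_add_mul_sq_pos_of_sq_le (s := √(s ^ 2 + x)) hb
      (by rwa [Real.sq_sqrt (by positivity)])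
    rwa [Real.sq_sqrt (by positivity)] at this
  have hD := sub_pos.2 hk
  have : 1 - s * alphaBetaLogDeriv ε k₁ k₂ s + x * alphaBetaSecondRatio ε k₁ k₂ s =
      (1 - s * alphaBetaLogDeriv ε k₁ k₂ s) * ((1 + k₁ * (s ^ 2 + x)) / (1 + k₁ * s ^ 2)) +
        x * (3 * (k₂ - k₁) / (4 * (1 + k₁ * s ^ 2) * (1 + k₂ * s ^ 2) ^ 2)) := by
    unfold alphaBetaSecondRatio
    generalize alphaBetaLogDeriv ε k₁ k₂ s = w
    have hA0 := h.ne'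
    have hB0 := hB.ne'
    rw [show 1 + k₁ * (s ^ 2 + x) = (1 + k₁ * s ^ 2) + k₁ * x by ring]
    generalize 1 + k₁ * s ^ 2 = A at hA0 ⊢
    generalize 1 + k₂ * s ^ 2 = B at hB0 ⊢
    field_simp
    ring
  rw [this]
  positivity

/-! ### Linear forms and directional derivatives on an inner product space -/

section InnerProduct

variable {V : Type*} [NormedAddCommGroup V] [InnerProductSpace ℝ V]

open scoped RealInnerProductSpace

theorem sq_apply_div_norm_le (β : V →L[ℝ] ℝ) (y : V) : (β y / ‖y‖) ^ 2 ≤ ‖β‖ ^ 2 := by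
  rw [sq_le_sq, abs_div, abs_norm, abs_norm]
  exact β.ratio_le_opNorm y

/-- Bessel's inequality for a linear form and two orthogonal vectors, the second one being the
component of `u` orthogonal to `y`. -/
theorem sq_apply_div_norm_add_le (β : V →L[ℝ] ℝ) {y u : V} (hy : y ≠ 0)
    (hΔ : 0 < ‖u‖ ^ 2 * ‖y‖ ^ 2 - ⟪y, u⟫ ^ 2) :
    (β y / ‖y‖) ^ 2 + (β u * ‖y‖ ^ 2 - β y * ⟪y, u⟫) ^ 2 /
      (‖y‖ ^ 2 * (‖u‖ ^ 2 * ‖y‖ ^ 2 - ⟪y, u⟫ ^ 2)) ≤ ‖β‖ ^ 2 := by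
  have hn : 0 < ‖y‖ := norm_pos_iff.2 hy
  have hn0 := hn.ne'
  set w : V := ‖y‖ ^ 2 • u - ⟪y, u⟫ • y with hw
  have hβw : β w = β u * ‖y‖ ^ 2 - β y * ⟪y, u⟫ := by
    simp [hw, mul_comm]
  have hyw : ⟪y, w⟫ = 0 := by
    rw [hw, inner_sub_right, real_inner_smul_right, real_inner_smul_right,
      real_inner_self_eq_norm_sq]; ring
  have hww : ‖w‖ ^ 2 = ‖y‖ ^ 2 * (‖u‖ ^ 2 * ‖y‖ ^ 2 - ⟪y, u⟫ ^ 2) := by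
    rw [hw, norm_sub_sq_real, norm_smul, norm_smul, real_inner_smul_left, real_inner_smul_right,
      real_inner_comm y u]
    simp only [mul_pow, Real.norm_eq_abs, sq_abs]
    ring
  have hwpos : 0 < ‖w‖ ^ 2 := by rw [hww]; positivity
  rw [← hβw, ← hww]
  -- `z` is the projection onto the span of `y` and `w` of the vector representing `β`, so `β z =
  -- ‖z‖² = S`; then `|β z| ≤ ‖β‖ ‖z‖` yields `S² ≤ ‖β‖² S`.
  set z : V := (β y / ‖y‖ ^ 2) • y + (β w / ‖w‖ ^ 2) • w with hz
  set S := (β y / ‖y‖) ^ 2 + β w ^ 2 / ‖w‖ ^ 2 with hS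
  have hβz : β z = S := by
    simp only [hz, hS, map_add, map_smul, smul_eq_mul]; ring
  have hzz : ‖z‖ ^ 2 = S := by
    rw [hz, norm_add_sq_real, norm_smul, norm_smul, real_inner_smul_left, real_inner_smul_right,
      hyw, hS]
    simp only [mul_pow, Real.norm_eq_abs, sq_abs]
    field_simp
    ring
  have hS0 : 0 ≤ S := by positivity
  have hle : S ^ 2 ≤ ‖β‖ ^ 2 * S := by
    rw [← hzz, ← mul_pow, ← pow_mul, pow_mul, hzz, ← hβz, ← sq_abs (β z)]
    exact pow_le_pow_left₀ (abs_nonneg _) (β.le_opNorm z) 2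
  rcases hS0.eq_or_lt with h0 | h0
  · rw [← h0]; positivity
  · nlinarith

/-- In dimension above one `V ∖ {0}` is connected, and the quotient equals `±‖β‖` at plus or minus
the Riesz vector of `β`; the intermediate value theorem does the rest. -/
theorem exists_ne_zero_apply_div_norm_eq [CompleteSpace V] (hV : 1 < Module.rank ℝ V)
    (β : V →L[ℝ] ℝ) {s : ℝ} (hs : |s| ≤ ‖β‖) : ∃ y : V, y ≠ 0 ∧ β y / ‖y‖ = s := by
  have hconn := (isConnected_compl_singleton_of_one_lt_rank hV (0 : V)).isPreconnected
  by_cases hβ : β = 0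
  · have : Nontrivial V := rank_pos_iff_nontrivial.1 (zero_lt_one.trans hV)
    obtain ⟨y, hy⟩ := exists_ne (0 : V)
    refine ⟨y, hy, ?_⟩
    subst hβ
    simp at hs
    simp [hs]
  set v : V := (InnerProductSpace.toDual ℝ V).symm β with hv
  have hvn : ‖v‖ = ‖β‖ := by simp [hv]
  have hv0 : v ≠ 0 := by rw [← norm_ne_zero_iff, hvn]; simpa using hβ
  have hvv : β v / ‖v‖ = ‖β‖ := by
    have : β v = ‖v‖ ^ 2 := by
      rw [← real_inner_self_eq_norm_sq]
      conv_rhs => rw [hv]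
      rw [InnerProductSpace.toDual_symm_apply]
    rw [this, ← hvn]
    have := norm_ne_zero_iff.2 hv0
    field_simp
  have hcont : ContinuousOn (fun y : V => β y / ‖y‖) {0}ᶜ :=
    β.continuous.continuousOn.div continuous_norm.continuousOn fun y hy => norm_ne_zero_iff.2 hy
  obtain ⟨y, hy, hys⟩ := hconn.intermediate_value (a := -v) (b := v) (by simpa using hv0)
    (by simpa using hv0) hcont
    (show s ∈ Set.Icc (β (-v) / ‖-v‖) (β v / ‖v‖) by
      rw [map_neg, norm_neg, neg_div, hvv]; exact abs_le.1 hs)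
  exact ⟨y, hy, hys⟩

theorem hasDerivAt_norm_add_smul {y u : V} (hy : y ≠ 0) :
    HasDerivAt (fun t : ℝ => ‖y + t • u‖) (⟪y, u⟫ / ‖y‖) 0 := by
  have h : HasDerivAt (fun t : ℝ => y + t • u) u 0 := by
    simpa using ((hasDerivAt_id (0 : ℝ)).smul_const u).const_add y
  have h2 := (h.norm_sq).sqrt (by simpa using hy)
  simp only [Real.sqrt_sq (norm_nonneg _), zero_smul, add_zero] at h2
  refine h2.congr_deriv ?_
  have := norm_ne_zero_iff.2 hy
  field_simp

theorem hasDerivAt_apply_add_smul (β : V →L[ℝ] ℝ) (y u : V) :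
    HasDerivAt (fun t : ℝ => β (y + t • u)) (β u) 0 := by
  simpa using ((hasDerivAt_id (0 : ℝ)).mul_const (β u)).const_add (β y)

theorem hasDerivAt_apply_div_norm_add_smul (β : V →L[ℝ] ℝ) {y : V} (u : V) (hy : y ≠ 0) :
    HasDerivAt (fun t : ℝ => β (y + t • u) / ‖y + t • u‖)
      ((β u - β y / ‖y‖ * (⟪y, u⟫ / ‖y‖)) / ‖y‖) 0 := by
  have hn := norm_ne_zero_iff.2 hy
  refine ((hasDerivAt_apply_add_smul β y u).div (hasDerivAt_norm_add_smul hy)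
    (by simpa using hy)).congr_deriv ?_
  simp only [zero_smul, add_zero]
  field_simp

/-- The derivative of `y ↦ ‖y‖ φ(β y / ‖y‖)` in the direction `u`, where `φ'` is the derivative
of `φ`. -/
noncomputable def alphaBetaDirDeriv (φ φ' : ℝ → ℝ) (β : V →L[ℝ] ℝ) (u y : V) : ℝ :=
  ⟪y, u⟫ / ‖y‖ * (φ (β y / ‖y‖) - β y / ‖y‖ * φ' (β y / ‖y‖)) + β u * φ' (β y / ‖y‖)

/-- The second derivative of `y ↦ ‖y‖ φ(β y / ‖y‖)` in the direction `u`, where `φ'` and `φ''`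
are the first two derivatives of `φ`. -/
noncomputable def alphaBetaDirDeriv₂ (φ φ' φ'' : ℝ → ℝ) (β : V →L[ℝ] ℝ) (u y : V) : ℝ :=
  (‖u‖ ^ 2 * ‖y‖ ^ 2 - ⟪y, u⟫ ^ 2) / ‖y‖ ^ 3 * (φ (β y / ‖y‖) - β y / ‖y‖ * φ' (β y / ‖y‖)) +
    (β u - β y / ‖y‖ * (⟪y, u⟫ / ‖y‖)) ^ 2 / ‖y‖ * φ'' (β y / ‖y‖)

theorem hasDerivAt_alphaBeta_add_smul {φ φ' : ℝ → ℝ} (β : V →L[ℝ] ℝ) {y : V} (u : V)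
    (hy : y ≠ 0) (hφ : HasDerivAt φ (φ' (β y / ‖y‖)) (β y / ‖y‖)) :
    HasDerivAt (fun t : ℝ => ‖y + t • u‖ * φ (β (y + t • u) / ‖y + t • u‖))
      (alphaBetaDirDeriv φ φ' β u y) 0 := by
  have hn := norm_ne_zero_iff.2 hy
  have hφ0 : HasDerivAt φ (φ' (β y / ‖y‖)) (β (y + (0 : ℝ) • u) / ‖y + (0 : ℝ) • u‖) := by
    simpa using hφ
  refine ((hasDerivAt_norm_add_smul hy).mul
    (hφ0.comp (0 : ℝ) (hasDerivAt_apply_div_norm_add_smul β u hy))).congr_deriv ?_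
  simp only [zero_smul, add_zero, alphaBetaDirDeriv, Function.comp]
  generalize φ' _ = p
  generalize φ _ = q
  field_simp
  ring

theorem hasDerivAt_alphaBetaDirDeriv_add_smul {φ φ' φ'' : ℝ → ℝ} (β : V →L[ℝ] ℝ) {y : V} (u : V)
    (hy : y ≠ 0) (hφ : HasDerivAt φ (φ' (β y / ‖y‖)) (β y / ‖y‖))
    (hφ' : HasDerivAt φ' (φ'' (β y / ‖y‖)) (β y / ‖y‖)) :
    HasDerivAt (fun t : ℝ => alphaBetaDirDeriv φ φ' β u (y + t • u))
      (alphaBetaDirDeriv₂ φ φ' φ'' β u y) 0 := by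
  have hn := norm_ne_zero_iff.2 hy
  have hσ := hasDerivAt_apply_div_norm_add_smul β u hy
  have hφ0 : HasDerivAt φ (φ' (β y / ‖y‖)) (β (y + (0 : ℝ) • u) / ‖y + (0 : ℝ) • u‖) := by
    simpa using hφ
  have hφ0' : HasDerivAt φ' (φ'' (β y / ‖y‖)) (β (y + (0 : ℝ) • u) / ‖y + (0 : ℝ) • u‖) := by
    simpa using hφ'
  have hi : HasDerivAt (fun t : ℝ => ⟪y + t • u, u⟫) (‖u‖ ^ 2) 0 := by
    simp only [inner_add_left, real_inner_smul_left, real_inner_self_eq_norm_sq]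
    simpa using ((hasDerivAt_id (0 : ℝ)).mul_const (‖u‖ ^ 2)).const_add ⟪y, u⟫
  have h1 := hi.div (hasDerivAt_norm_add_smul (u := u) hy) (by simpa using hy)
  have hc := hφ0.comp (0 : ℝ) hσ
  have hc' := hφ0'.comp (0 : ℝ) hσ
  refine ((h1.mul (hc.sub (hσ.mul hc'))).add (hc'.const_mul (β u))).congr_deriv ?_
  simp only [zero_smul, add_zero, alphaBetaDirDeriv₂, Function.comp, Pi.div_apply, Pi.sub_apply,
    Pi.mul_apply]
  generalize φ'' _ = p₂
  generalize φ' _ = p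
  generalize φ _ = q
  field_simp
  ring

theorem deriv_deriv_sq_alphaBeta {φ φ' φ'' : ℝ → ℝ} (β : V →L[ℝ] ℝ) {y : V} (u : V)
    (hy : y ≠ 0) (hφ : ∀ s, s ^ 2 ≤ ‖β‖ ^ 2 → HasDerivAt φ (φ' s) s)
    (hφ' : ∀ s, s ^ 2 ≤ ‖β‖ ^ 2 → HasDerivAt φ' (φ'' s) s) :
    deriv (fun s : ℝ => deriv (fun t : ℝ =>
      (‖y + s • u + t • u‖ * φ (β (y + s • u + t • u) / ‖y + s • u + t • u‖)) ^ 2) 0) 0 =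
    2 * (alphaBetaDirDeriv φ φ' β u y ^ 2 +
      ‖y‖ * φ (β y / ‖y‖) * alphaBetaDirDeriv₂ φ φ' φ'' β u y) := by
  -- The first derivative formula needs a nonzero base point, which is only available for `s` near
  -- `0`; that suffices for the outer derivative.
  have hne : ∀ᶠ s : ℝ in nhds 0, y + s • u ≠ 0 := by
    have hc : Continuous fun s : ℝ => y + s • u := by fun_prop
    exact hc.continuousAt.eventually_ne (by simpa using hy)
  have hev : (fun s : ℝ => deriv (fun t : ℝ =>
      (‖y + s • u + t • u‖ * φ (β (y + s • u + t • u) / ‖y + s • u + t • u‖)) ^ 2) 0) =ᶠ[nhds 0]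
      fun s : ℝ => 2 * (‖y + s • u‖ * φ (β (y + s • u) / ‖y + s • u‖) *
        alphaBetaDirDeriv φ φ' β u (y + s • u)) := by
    filter_upwards [hne] with s hs
    have h := (hasDerivAt_alphaBeta_add_smul β u hs (hφ _ (sq_apply_div_norm_le β _))).pow 2
    refine (h.congr_deriv ?_).deriv
    simp only [zero_smul, add_zero]
    push_cast
    ring
  rw [hev.deriv_eq]
  have hφy := hφ _ (sq_apply_div_norm_le β y)
  have h := ((hasDerivAt_alphaBeta_add_smul β u hy hφy).mul
    (hasDerivAt_alphaBetaDirDeriv_add_smul β u hy hφy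
      (hφ' _ (sq_apply_div_norm_le β y)))).const_mul 2
  refine (h.congr_deriv ?_).deriv
  simp only [zero_smul, add_zero]
  ring

/-- The second derivative of `F ^ 2` for `F y = ‖y‖ φ(β y / ‖y‖)` is positive, provided
that `φ` is positive and satisfies the usual convexity inequality for `(α, β)`-metrics. -/
theorem dirDeriv_sq_add_mul_dirDeriv₂_pos {φ φ' φ'' : ℝ → ℝ} (β : V →L[ℝ] ℝ) {y u : V}
    (hy : y ≠ 0) (hu : u ≠ 0) (hpos : 0 < φ (β y / ‖y‖))
    (hconv : ∀ s x, 0 ≤ x → s ^ 2 + x ≤ ‖β‖ ^ 2 → 0 < φ s - s * φ' s + x * φ'' s) :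
    0 < alphaBetaDirDeriv φ φ' β u y ^ 2 +
      ‖y‖ * φ (β y / ‖y‖) * alphaBetaDirDeriv₂ φ φ' φ'' β u y := by
  have hn : 0 < ‖y‖ := norm_pos_iff.2 hy
  have hn0 := hn.ne'
  have hcs : 0 ≤ ‖u‖ ^ 2 * ‖y‖ ^ 2 - ⟪y, u⟫ ^ 2 := by
    have := real_inner_mul_inner_self_le y u
    rw [real_inner_self_eq_norm_sq, real_inner_self_eq_norm_sq] at this
    nlinarith
  rcases hcs.eq_or_lt with h0 | hΔ
  -- Equality in Cauchy–Schwarz: `u = r y` with `r ≠ 0`. By homogeneity `F` is linear along the ray,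
  -- so `D_u F = rF ≠ 0` and `D_u² F = 0`.
  · have habs : |⟪y, u⟫ / (‖y‖ * ‖u‖)| = 1 := by
      have hun := norm_ne_zero_iff.2 hu
      rw [← sq_eq_sq₀ (abs_nonneg _) zero_le_one, sq_abs, div_pow, mul_pow, one_pow,
        div_eq_one_iff_eq (by positivity)]
      linarith
    obtain ⟨-, r, hr, rfl⟩ := abs_real_inner_div_norm_mul_norm_eq_one_iff y u |>.1 habs
    have h1 : alphaBetaDirDeriv φ φ' β (r • y) y = r * (‖y‖ * φ (β y / ‖y‖)) := by
      simp only [alphaBetaDirDeriv, real_inner_smul_right, real_inner_self_eq_norm_sq, map_smul,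
        smul_eq_mul]
      field_simp
      ring
    have h2 : alphaBetaDirDeriv₂ φ φ' φ'' β (r • y) y = 0 := by
      rw [alphaBetaDirDeriv₂, ← h0]
      simp only [real_inner_smul_right, real_inner_self_eq_norm_sq, map_smul, smul_eq_mul]
      have : r * β y - β y / ‖y‖ * (r * ‖y‖ ^ 2 / ‖y‖) = 0 := by field_simp; ring
      rw [this]
      simp
    rw [h1, h2, mul_zero, add_zero]
    positivity
  -- Here `x` is the squared value of `β` on the unit vector along the component of `u` orthogonal
  -- to `y`.
  · have hW := hconv (β y / ‖y‖) _ (by positivity) (sq_apply_div_norm_add_le β hy hΔ)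
    have h2 : alphaBetaDirDeriv₂ φ φ' φ'' β u y =
        (‖u‖ ^ 2 * ‖y‖ ^ 2 - ⟪y, u⟫ ^ 2) / ‖y‖ ^ 3 *
        (φ (β y / ‖y‖) - β y / ‖y‖ * φ' (β y / ‖y‖) +
          (β u * ‖y‖ ^ 2 - β y * ⟪y, u⟫) ^ 2 /
            (‖y‖ ^ 2 * (‖u‖ ^ 2 * ‖y‖ ^ 2 - ⟪y, u⟫ ^ 2)) * φ'' (β y / ‖y‖)) := by
      rw [alphaBetaDirDeriv₂]
      have hΔ0 := hΔ.ne'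
      generalize ‖u‖ ^ 2 * ‖y‖ ^ 2 - ⟪y, u⟫ ^ 2 = Δ at hΔ0 ⊢
      generalize φ'' _ = p₂
      generalize φ' _ = p
      generalize φ _ = q
      field_simp
    have : 0 < alphaBetaDirDeriv₂ φ φ' φ'' β u y := by
      rw [h2]; positivity
    positivity

end InnerProduct

/-! ### Smoothness on the tangent bundle and sufficiency of the condition -/

section Manifold

variable {E : Type*} [NormedAddCommGroup E] [NormedSpace ℝ E]
  {H : Type*} [TopologicalSpace H] {I : ModelWithCorners ℝ E H}
  {M : Type*} [TopologicalSpace M] [ChartedSpace H M]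

theorem contMDiff_oneForm_tangentBundle [IsManifold I ∞ M]
    {β : (x : M) → TangentSpace I x →L[ℝ] ℝ}
    (hβ : ContMDiff I (I.prod 𝓘(ℝ, E →L[ℝ] ℝ)) ∞
      (fun x => Bundle.TotalSpace.mk' (E →L[ℝ] ℝ)
        (E := fun x : M => TangentSpace I x →L[ℝ] ℝ) x (β x))) :
    ContMDiff I.tangent 𝓘(ℝ) ∞ (fun p : TangentBundle I M => β p.1 p.2) := by
  intro p
  have hid : ContMDiffAt I.tangent I.tangent ∞
    (fun p : TangentBundle I M => Bundle.TotalSpace.mk' E p.1 p.2) p := contMDiffAt_id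
  have hproj : ContMDiffAt I.tangent I ∞ (fun p : TangentBundle I M => p.1) p :=
    (Bundle.contMDiff_proj (fun x : M => TangentSpace I x)).contMDiffAt
  -- The pulled-back form is paired with the tautological section, with values in the trivial line
  -- bundle; the fibre component is the desired function.
  have h : ContMDiffAt I.tangent (I.prod 𝓘(ℝ)) ∞ (fun p : TangentBundle I M =>
      Bundle.TotalSpace.mk' ℝ (E := Bundle.Trivial M ℝ) p.1 (β p.1 p.2)) p :=
    ContMDiffAt.clm_bundle_apply (F₁ := E) (F₂ := ℝ) (E₁ := fun x : M => TangentSpace I x)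
      (E₂ := Bundle.Trivial M ℝ) (ϕ := fun p : TangentBundle I M => β p.1)
      (hβ.contMDiffAt.comp p hproj) hid
  simp only [Bundle.contMDiffAt_totalSpace] at h
  exact h.2

variable [Bundle.RiemannianBundle (fun x : M => TangentSpace I x)]

theorem alphaBetaMetric_smul (φ : ℝ → ℝ) (β : (x : M) → TangentSpace I x →L[ℝ] ℝ) (x : M)
    (y : TangentSpace I x) {c : ℝ} (hc : 0 < c) :
    alphaBetaMetric I φ β x (c • y) = c * alphaBetaMetric I φ β x y := by
  have hn : ‖c • y‖ = c * ‖y‖ := by rw [norm_smul, Real.norm_eq_abs, abs_of_pos hc]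
  simp only [alphaBetaMetric]
  rw [hn, map_smul, smul_eq_mul, mul_div_mul_left _ _ hc.ne', mul_assoc]

variable [IsManifold I ∞ M]
  [IsContMDiffRiemannianBundle I ∞ E (fun x : M => TangentSpace I x)]

theorem contMDiffAt_norm_tangentBundle {p : TangentBundle I M} (hp : p.2 ≠ 0) :
    ContMDiffAt I.tangent 𝓘(ℝ) ∞ (fun p : TangentBundle I M => ‖p.2‖) p := by
  have hid : ContMDiffAt I.tangent I.tangent ∞
    (fun p : TangentBundle I M => Bundle.TotalSpace.mk' E p.1 p.2) p := contMDiffAt_id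
  have h : ContMDiffAt I.tangent 𝓘(ℝ) ∞ (fun p : TangentBundle I M => inner ℝ p.2 p.2) p :=
    ContMDiffAt.inner_bundle hid hid
  have hne : inner ℝ p.2 p.2 ≠ 0 := inner_self_ne_zero.2 hp
  refine ((Real.contDiffAt_sqrt hne).contMDiffAt.comp p h).congr_of_eventuallyEq
    (Filter.Eventually.of_forall fun q => ?_)
  exact norm_eq_sqrt_real_inner q.2

theorem contMDiffOn_alphaBetaMetric {φ : ℝ → ℝ} {β : (x : M) → TangentSpace I x →L[ℝ] ℝ}
    (hβ : ContMDiff I (I.prod 𝓘(ℝ, E →L[ℝ] ℝ)) ∞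
      (fun x => Bundle.TotalSpace.mk' (E →L[ℝ] ℝ)
        (E := fun x : M => TangentSpace I x →L[ℝ] ℝ) x (β x)))
    (hφ : ∀ (x : M) (y : TangentSpace I x), y ≠ 0 → ContDiffAt ℝ ∞ φ (β x y / ‖y‖)) :
    ContMDiffOn I.tangent 𝓘(ℝ) ∞ (fun p : TangentBundle I M => alphaBetaMetric I φ β p.1 p.2)
      {p : TangentBundle I M | p.2 ≠ 0} := by
  intro p hp
  have hn := contMDiffAt_norm_tangentBundle hp
  have hσ := ((contMDiff_oneForm_tangentBundle hβ).contMDiffAt (x := p)).div₀ hn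
    (norm_ne_zero_iff.2 hp)
  exact (hn.mul ((hφ p.1 p.2 hp).contMDiffAt.comp p hσ)).contMDiffWithinAt

theorem isPositiveDefiniteFinsler_alphaBetaPhi {β : (x : M) → TangentSpace I x →L[ℝ] ℝ}
    (hβ : ContMDiff I (I.prod 𝓘(ℝ, E →L[ℝ] ℝ)) ∞
      (fun x => Bundle.TotalSpace.mk' (E →L[ℝ] ℝ)
        (E := fun x : M => TangentSpace I x →L[ℝ] ℝ) x (β x)))
    [IsManifold I 1 M] {ε k₁ k₂ : ℝ} (hε : ε ^ 2 = 1) (hk : k₁ < k₂)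
    (hb : ∀ x : M, 0 < 1 + k₁ * ‖β x‖ ^ 2) :
    IsPositiveDefiniteFinsler I (alphaBetaMetric I (alphaBetaPhi ε k₁ k₂) β) where
  smooth := contMDiffOn_alphaBetaMetric hβ fun x y _ => contDiffAt_alphaBetaPhi ε hk
    (one_add_mul_sq_pos_of_sq_le (hb x) (sq_apply_div_norm_le (β x) y))
  pos x y hy := mul_pos (norm_pos_iff.2 hy) (alphaBetaPhi_pos ε hk
    (one_add_mul_sq_pos_of_sq_le (hb x) (sq_apply_div_norm_le (β x) y)))
  homogeneous x y c hc := alphaBetaMetric_smul _ β x y hc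
  posDef x y hy u hu := by
    have hpos : ∀ s, s ^ 2 ≤ ‖β x‖ ^ 2 → 0 < 1 + k₁ * s ^ 2 := fun s hs =>
      one_add_mul_sq_pos_of_sq_le (hb x) hs
    have key := deriv_deriv_sq_alphaBeta (φ := alphaBetaPhi ε k₁ k₂)
      (φ' := fun s => alphaBetaPhi ε k₁ k₂ s * alphaBetaLogDeriv ε k₁ k₂ s)
      (φ'' := fun s => alphaBetaPhi ε k₁ k₂ s * alphaBetaSecondRatio ε k₁ k₂ s)
      (β x) u hy (fun s hs => hasDerivAt_alphaBetaPhi ε hk (hpos s hs)) fun s hs =>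
        ((hasDerivAt_alphaBetaPhi ε hk (hpos s hs)).mul
          (hasDerivAt_alphaBetaLogDeriv hε hk (hpos s hs))).congr_deriv (by ring)
    unfold fundamentalTensor
    simp only [alphaBetaMetric]
    rw [key]
    refine mul_pos one_half_pos (mul_pos two_pos (dirDeriv_sq_add_mul_dirDeriv₂_pos (β x) hy hu
      (alphaBetaPhi_pos ε hk (hpos _ (sq_apply_div_norm_le (β x) y))) fun s z hz hsz => ?_))
    have h1 := mul_pos (alphaBetaPhi_pos ε hk (hpos s (by linarith)))
      (one_sub_add_mul_alphaBetaSecondRatio_pos hε hk (hb x) hz hsz)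
    linarith

end Manifold

/-! ### The equivalence -/

theorem lemma3p1
    {M : Type*} [TopologicalSpace M] [ChartedSpace (EuclideanSpace ℝ (Fin 2)) M]
    [IsManifold (𝓡 2) ∞ M]
    -- the Riemannian metric `α`
    [Bundle.RiemannianBundle (fun x : M => TangentSpace (𝓡 2) x)]
    [IsContMDiffRiemannianBundle (𝓡 2) ∞ (EuclideanSpace ℝ (Fin 2))
      (fun x : M => TangentSpace (𝓡 2) x)]
    -- the smooth `1`-form `β`
    (β : (x : M) → TangentSpace (𝓡 2) x →L[ℝ] ℝ)
    (hβ : ContMDiff (𝓡 2) ((𝓡 2).prod 𝓘(ℝ, EuclideanSpace ℝ (Fin 2) →L[ℝ] ℝ)) ∞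
      (fun x => Bundle.TotalSpace.mk' (EuclideanSpace ℝ (Fin 2) →L[ℝ] ℝ)
        (E := fun x : M => TangentSpace (𝓡 2) x →L[ℝ] ℝ) x (β x)))
    (ε k₁ k₂ : ℝ) (hε : ε = 1 ∨ ε = -1) (hk : k₁ < k₂) :
    (IsPositiveDefiniteFinsler (𝓡 2) (alphaBetaMetric (𝓡 2) (alphaBetaPhi ε k₁ k₂) β) ↔
      ∀ x : M, 0 < 1 + k₁ * ‖β x‖ ^ 2) ∧
    ((∀ x : M, 0 < 1 + k₁ * ‖β x‖ ^ 2) →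
      ∀ (x : M) (y : TangentSpace (𝓡 2) x), y ≠ 0 →
        AlphaBetaPhiDefinedAt k₁ k₂ (β x y / ‖y‖)) := by
  have hε2 : ε ^ 2 = 1 := by rcases hε with rfl | rfl <;> norm_num
  refine ⟨⟨fun hF x => ?_, isPositiveDefiniteFinsler_alphaBetaPhi hβ hε2 hk⟩, fun hb x y _ =>
    alphaBetaPhiDefinedAt_of_pos hk
      (one_add_mul_sq_pos_of_sq_le (hb x) (sq_apply_div_norm_le (β x) y))⟩
  by_contra! hneg
  have hk₁ : k₁ < 0 := by
    by_contra! h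
    nlinarith [mul_nonneg h (sq_nonneg ‖β x‖)]
  -- The positive root of `1 + k₁s²`, where `φ` vanishes.
  have hzero : 1 + k₁ * √(-k₁)⁻¹ ^ 2 = 0 := by
    rw [Real.sq_sqrt (inv_nonneg.2 (neg_pos.2 hk₁).le)]
    have := hk₁.ne
    field_simp
    ring
  have hle : |√(-k₁)⁻¹| ≤ ‖β x‖ := by
    refine abs_le_of_sq_le_sq ?_ (norm_nonneg (β x))
    nlinarith
  have hfin : FiniteDimensional ℝ (TangentSpace (𝓡 2) x) :=
    inferInstanceAs (FiniteDimensional ℝ (EuclideanSpace ℝ (Fin 2)))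
  -- Dimension two matters here: on a line `β/α` takes only the values `±b` and could miss the root.
  have hrank : 1 < Module.rank ℝ (TangentSpace (𝓡 2) x) := by
    change 1 < Module.rank ℝ (EuclideanSpace ℝ (Fin 2))
    rw [← Module.finrank_eq_rank, finrank_euclideanSpace_fin]
    norm_num
  have hcomplete : CompleteSpace (TangentSpace (𝓡 2) x) := FiniteDimensional.complete ℝ _
  obtain ⟨y, hy, hys⟩ := exists_ne_zero_apply_div_norm_eq hrank (β x) hle
  have hFy := hF.pos x y hy
  rw [alphaBetaMetric, hys, alphaBetaPhi_eq_zero ε hzero, mul_zero] at hFy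
  exact lt_irrefl _ hFy
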